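/- Let $p$ be a prime and $n\ge 1$, let $V_n=\mathbb F_p^n$, and write $\mathrm{GL}_n=\mathrm{GL}_n(\mathbb F_p)$. All modules are right $\mathbb F_p[\mathrm{GL}_n]$-modules. Let $\mathrm{GL}_{n-1}$ be regarded as a subgroup of $\mathrm{GL}_n$ via $g\mapsto\begin{pmatrix} g&0\\0&1\end{pmatrix}$ (with $\mathrm{GL}_0$ the trivial group), and let $\mathrm{Ind}_{\mathrm{GL}_{n-1}}^{\mathrm{GL}_n}(M)=M\otimes_{\mathbb F_p[\mathrm{GL}_{n-1}]}\mathbb F_p[\mathrm{GL}_n]$ be the induction functor. Let $\mathrm{St}_n$ be the Steinberg representation of $\mathrm{GL}_n$ over $\mathbb F_p$, that is, the right ideal of $\mathbb F_p[\mathrm{GL}_n]$ generated by $\bigl(\sum_{b\in B_n} b\bigr)\bigl(\sum_{w\in S_n}\mathrm{sgn}(w)\,w\bigr)$, where $B_n\subset\mathrm{GL}_n$ is the group of upper triangular matrices and $S_n\subset\mathrm{GL}_n$ the group of permutation matrices. Let $\mathcal J(V_n)$ be the quotient of the vector space $\mathbb F_p^{V_n}$ of all set maps $V_n\to\mathbb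 F_p$ by the subspace of constant maps, with right action $\phi\cdot g=\phi\circ g$, and let $\mathcal J(V_n)^\#$ be its contragredient, that is, the dual space $\mathcal J(V_n)^*$ with $(f\cdot g)(x)=f(x\cdot g^{-1})$. Tensor products over $\mathbb F_p$ carry the diagonal action. Then there is an isomorphism of $\mathbb F_p[\mathrm{GL}_n]$-modules $$\mathrm{Ind}_{\mathrm{GL}_{n-1}}^{\mathrm{GL}_n}(\mathrm{St}_{n-1})\;\cong\;\mathcal J(V_n)^\#\otimes \mathrm{St}_n .$$ -/

import Mathlib

namespace GLSteinberg

open scoped MonoidAlgebra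

noncomputable section

/-- The finite general linear group `GL_n(𝔽_p)`. -/
abbrev GLp (p n : ℕ) : Type := Matrix.GeneralLinearGroup (Fin n) (ZMod p)

/-- The group algebra `𝔽_p[GL_n(𝔽_p)]`. -/
abbrev GrpAlg (p n : ℕ) : Type := MonoidAlgebra (ZMod p) (GLp p n)

/-- The `GL_n(𝔽_p)`-modules considered here are right `𝔽_p[GL_n(𝔽_p)]`-modules, encoded as
representations of the opposite group: `ρ (MulOpposite.op g) x` stands for `x · g`. -/
abbrev RightRep (p n : ℕ) (M : Type) [AddCommGroup M] [Module (ZMod p) M] : Type :=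
  Representation (ZMod p) (GLp p n)ᵐᵒᵖ M

/-- The multiplicative map `A ↦ [A 0; 0 1]` from `n × n` to `(n+1) × (n+1)` matrices. -/
def blockHom (p n : ℕ) :
    Matrix (Fin n) (Fin n) (ZMod p) →* Matrix (Fin (n + 1)) (Fin (n + 1)) (ZMod p) where
  toFun A := Matrix.reindex finSumFinEquiv finSumFinEquiv
    (Matrix.fromBlocks A 0 0 (1 : Matrix (Fin 1) (Fin 1) (ZMod p)))
  map_one' := by simp
  map_mul' A B := by simp [Matrix.submatrix_mul_equiv, Matrix.fromBlocks_multiply]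

/-- The standard inclusion `GL_n(𝔽_p) → GL_{n+1}(𝔽_p)`, `g ↦ [g 0; 0 1]`. -/
def glIncl (p n : ℕ) : GLp p n →* GLp p (n + 1) := Units.map (blockHom p n)

/-- The permutation matrix of `w`, as an element of `GL_n(𝔽_p)`. -/
def permGL (p n : ℕ) : Equiv.Perm (Fin n) →* GLp p n :=
  (Matrix.permMatrixHom (R := ZMod p) (n := Fin n)).toHomUnits

open scoped Classical in
/-- The sum in the group algebra of the elements of the Borel subgroup of upper triangular
matrices. -/
def borelSum (p n : ℕ) [Fact p.Prime] : GrpAlg p n :=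
  ∑ b ∈ Finset.univ.filter
    (fun b : GLp p n => (b : Matrix (Fin n) (Fin n) (ZMod p)).IsUpperTriangular),
    MonoidAlgebra.single b 1

/-- The signed sum in the group algebra of the permutation matrices. -/
def signedPermSum (p n : ℕ) : GrpAlg p n :=
  ∑ w : Equiv.Perm (Fin n),
    MonoidAlgebra.single (permGL p n w) ((Equiv.Perm.sign w : ℤ) : ZMod p)

/-- Steinberg's element `(∑_{b ∈ B} b) (∑_w sgn(w) w)`; it is an invertible scalar times the
Steinberg idempotent. -/
def steinbergElt (p n : ℕ) [Fact p.Prime] : GrpAlg p n :=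
  borelSum p n * signedPermSum p n

/-- The right regular module: `x · g` is the product in the group algebra. -/
def rightRegular (p n : ℕ) : RightRep p n (GrpAlg p n) where
  toFun g := LinearMap.mulRight (ZMod p) (MonoidAlgebra.single g.unop 1)
  map_one' := by
    refine LinearMap.ext fun x => ?_
    simp [← MonoidAlgebra.one_def]
  map_mul' g h := by
    refine LinearMap.ext fun x => ?_
    simp [mul_assoc, MonoidAlgebra.single_mul_single]

/-- The right ideal `e 𝔽_p[GL_n(𝔽_p)]` generated by Steinberg's element `e`. -/
def steinbergIdeal (p n : ℕ) [Fact p.Prime] : Submodule (ZMod p) (GrpAlg p n) :=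
  LinearMap.range (LinearMap.mulLeft (ZMod p) (steinbergElt p n))

/-- The Steinberg representation `St_n` of `GL_n(𝔽_p)` over `𝔽_p`: the right ideal of the group
algebra generated by Steinberg's element. -/
def St (p n : ℕ) [Fact p.Prime] : RightRep p n (steinbergIdeal p n) :=
  (rightRegular p n).subrepresentation (steinbergIdeal p n) (by
    rintro g _ ⟨x, rfl⟩
    exact ⟨x * MonoidAlgebra.single g.unop 1, by simp [rightRegular, mul_assoc]⟩)

/-- The space of all set maps `V_n = 𝔽_p^n → 𝔽_p`. -/
abbrev Fun (p n : ℕ) : Type := (Fin n → ZMod p) → ZMod p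

/-- The right action of `GL_n(𝔽_p)` on set maps `V_n → 𝔽_p` by precomposition: `φ · g = φ ∘ g`. -/
def funRep (p n : ℕ) : RightRep p n (Fun p n) where
  toFun g := LinearMap.funLeft (ZMod p) (ZMod p)
    (fun v => (g.unop : Matrix (Fin n) (Fin n) (ZMod p)).mulVec v)
  map_one' := by
    refine LinearMap.ext fun φ => funext fun v => ?_
    simp [LinearMap.funLeft_apply]
  map_mul' g h := by
    refine LinearMap.ext fun φ => funext fun v => ?_
    simp [LinearMap.funLeft_apply, Matrix.mulVec_mulVec]

/-- The line of constant maps `V_n → 𝔽_p`. -/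
def constFun (p n : ℕ) : Submodule (ZMod p) (Fun p n) :=
  LinearMap.range (LinearMap.pi fun _ : Fin n → ZMod p => (LinearMap.id : ZMod p →ₗ[ZMod p] ZMod p))

/-- `J(V_n)`: the set maps `V_n → 𝔽_p` modulo the constant maps, with the right action induced by
precomposition. -/
def J (p n : ℕ) : RightRep p n (Fun p n ⧸ constFun p n) :=
  (funRep p n).quotient (constFun p n) (by
    rintro g _ ⟨c, rfl⟩
    exact ⟨c, rfl⟩)

/-- Induction of right modules along `GL_n(𝔽_p) → GL_{n+1}(𝔽_p)`, that is
`M ↦ M ⊗_{𝔽_p[GL_n]} 𝔽_p[GL_{n+1}]`. -/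
abbrev Ind (p n : ℕ) {M : Type} [AddCommGroup M] [Module (ZMod p) M] (ρ : RightRep p n M) :
    RightRep p (n + 1) (Representation.IndV (MonoidHom.op (glIncl p n)) ρ) :=
  Representation.ind (MonoidHom.op (glIncl p n)) ρ

end

end GLSteinberg

/-! Write `e_n` for Steinberg's element, `ι` for the inclusion of `GL_n` in `GL_{n+1}`, `v₀` for the
last basis vector and `P` for its stabilizer in `GL_{n+1}`. Functionals on functions modulo
constants form the augmentation ideal of `𝔽_p[V]`, spanned by the differences `δ_v - δ_0` (`evalSub
v`), and `P` fixes `δ_{v₀} - δ_0`.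

The element `e_{n+1}` is a left multiple `D ι(e_n)`, so left multiplication by `D` is a `GL_n`-map
`e_n x ↦ e_{n+1} ι(x)` from `St_n` to `St_{n+1}`. Tensoring with `δ_{v₀} - δ_0` and applying
Frobenius reciprocity gives the map `F` out of the induced module.

Surjectivity rests on `St_{n+1}` being spanned by `e_{n+1} P` (`steinbergElt_mul_gel_mem`), a row
reduction driven by the three-term relation `steinbergElt_relation`. The image then contains
`(δ_{v₀} - δ_0) ⊗ St_{n+1}`, and everything else by transitivity on nonzero vectors.

Injectivity comes from restricting functions on `GL_{n+1}` to `GL_n`: this sends `e_{n+1}` to `e_n`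
and kills `e_{n+1} h` for `h` in `P` outside `GL_n`. Summed over cosets, it yields the linear left
inverse `toInd` of `F`, so no dimension count is needed. -/

namespace GLSteinberg

open scoped MonoidAlgebra TensorProduct

noncomputable section

/-! ### Relations satisfied by Steinberg's element -/

section

variable {p n : ℕ}

/-- The image of a group element in the group algebra. -/
def gel (g : GLp p n) : GrpAlg p n := MonoidAlgebra.single g 1

lemma gel_mul_gel (g h : GLp p n) : gel g * gel h = gel (g * h) := by
  simp [gel, MonoidAlgebra.single_mul_single]

lemma gel_one : gel (1 : GLp p n) = 1 := rfl

lemma mul_gel_mul_gel (x : GrpAlg p n) (g h : GLp p n) :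
    x * gel g * gel h = x * gel (g * h) := by
  rw [mul_assoc, gel_mul_gel]

lemma coeff_mul_gel (x : GrpAlg p n) (g h : GLp p n) :
    (x * gel g).coeff h = x.coeff (h * g⁻¹) := by
  simp [gel]

lemma single_eq_smul_gel (g : GLp p n) (r : ZMod p) :
    (MonoidAlgebra.single g r : GrpAlg p n) = r • gel g := by
  simp [gel]

lemma isUpperTriangular_inv {b : GLp p n}
    (hb : (b : Matrix (Fin n) (Fin n) (ZMod p)).IsUpperTriangular) :
    ((b⁻¹ : GLp p n) : Matrix (Fin n) (Fin n) (ZMod p)).IsUpperTriangular := by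
  rw [Matrix.GeneralLinearGroup.coe_inv]
  have : Invertible (b : Matrix (Fin n) (Fin n) (ZMod p)) := b.invertible
  exact Matrix.blockTriangular_inv_of_blockTriangular hb

lemma isUpperTriangular_mul {a b : GLp p n}
    (ha : (a : Matrix (Fin n) (Fin n) (ZMod p)).IsUpperTriangular)
    (hb : (b : Matrix (Fin n) (Fin n) (ZMod p)).IsUpperTriangular) :
    ((a * b : GLp p n) : Matrix (Fin n) (Fin n) (ZMod p)).IsUpperTriangular := by
  rw [Matrix.GeneralLinearGroup.coe_mul]
  exact Matrix.BlockTriangular.mul ha hb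

open scoped Classical in
lemma coeff_borelSum [Fact p.Prime] (g : GLp p n) :
    (borelSum p n).coeff g =
      if (g : Matrix (Fin n) (Fin n) (ZMod p)).IsUpperTriangular then 1 else 0 := by
  rw [borelSum, MonoidAlgebra.coeff_sum, Finsupp.finsetSum_apply]
  simp [Finsupp.single_apply]

lemma borelSum_mul_gel [Fact p.Prime] {b : GLp p n}
    (hb : (b : Matrix (Fin n) (Fin n) (ZMod p)).IsUpperTriangular) :
    borelSum p n * gel b = borelSum p n := by
  classical
  ext g
  rw [coeff_mul_gel, coeff_borelSum, coeff_borelSum]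
  refine if_congr ⟨fun h => ?_, fun h => isUpperTriangular_mul h (isUpperTriangular_inv hb)⟩ rfl rfl
  simpa using isUpperTriangular_mul h hb

lemma permGL_apply (w : Equiv.Perm (Fin n)) (r c : Fin n) :
    (permGL p n w : Matrix (Fin n) (Fin n) (ZMod p)) r c = if w⁻¹ r = c then 1 else 0 := by
  change (w⁻¹.permMatrix (ZMod p)) r c = _
  simp [Equiv.Perm.permMatrix, PEquiv.toMatrix_apply, Equiv.toPEquiv_apply, eq_comm]

lemma permGL_mul_apply (w : Equiv.Perm (Fin n)) (g : GLp p n) (r c : Fin n) :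
    ((permGL p n w * g : GLp p n) : Matrix (Fin n) (Fin n) (ZMod p)) r c =
      (g : Matrix (Fin n) (Fin n) (ZMod p)) (w⁻¹ r) c := by
  simp [Matrix.mul_apply, permGL_apply]

lemma mul_permGL_apply (w : Equiv.Perm (Fin n)) (g : GLp p n) (r c : Fin n) :
    ((g * permGL p n w : GLp p n) : Matrix (Fin n) (Fin n) (ZMod p)) r c =
      (g : Matrix (Fin n) (Fin n) (ZMod p)) r (w c) := by
  simp [Matrix.mul_apply, permGL_apply, Equiv.symm_apply_eq, Equiv.Perm.inv_def]

lemma mul_permGL_inv_apply (w : Equiv.Perm (Fin n)) (g : GLp p n) (r c : Fin n) :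
    ((g * (permGL p n w)⁻¹ : GLp p n) : Matrix (Fin n) (Fin n) (ZMod p)) r c =
      (g : Matrix (Fin n) (Fin n) (ZMod p)) r (w⁻¹ c) := by
  rw [← map_inv, mul_permGL_apply]

/-- If `w k w⁻¹` is upper triangular, it is absorbed by the sum over the Borel subgroup. -/
lemma borelSum_mul_permGL_mul_gel [Fact p.Prime] {w : Equiv.Perm (Fin n)} {k : GLp p n}
    (hk : ∀ r c, w c < w r → (k : Matrix (Fin n) (Fin n) (ZMod p)) r c = 0) :
    borelSum p n * gel (permGL p n w) * gel k = borelSum p n * gel (permGL p n w) := by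
  have h : gel (permGL p n w) * gel k
      = gel (permGL p n w * k * (permGL p n w)⁻¹) * gel (permGL p n w) := by
    simp [gel_mul_gel]
  rw [mul_assoc, h, ← mul_assoc, borelSum_mul_gel]
  intro r c hrc
  rw [mul_permGL_inv_apply, permGL_mul_apply]
  exact hk _ _ (by simpa using hrc)

lemma signedPermSum_eq :
    signedPermSum p n =
      ∑ w : Equiv.Perm (Fin n), ((Equiv.Perm.sign w : ℤ) : ZMod p) • gel (permGL p n w) := by
  simp [signedPermSum, gel]

lemma steinbergElt_eq [Fact p.Prime] :
    steinbergElt p n = ∑ w : Equiv.Perm (Fin n),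
      ((Equiv.Perm.sign w : ℤ) : ZMod p) • (borelSum p n * gel (permGL p n w)) := by
  simp [steinbergElt, signedPermSum_eq, Finset.mul_sum]

/-- Diagonal matrices fix Steinberg's element. -/
lemma steinbergElt_mul_gel_of_diagonal [Fact p.Prime] {t : GLp p n}
    (ht : ∀ r c, r ≠ c → (t : Matrix (Fin n) (Fin n) (ZMod p)) r c = 0) :
    steinbergElt p n * gel t = steinbergElt p n := by
  rw [steinbergElt_eq, Finset.sum_mul]
  refine Finset.sum_congr rfl fun w _ => ?_
  rw [smul_mul_assoc, borelSum_mul_permGL_mul_gel]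
  exact fun r c h => ht r c (by rintro rfl; exact lt_irrefl _ h)

/-- Permutation matrices act on Steinberg's element by their sign. -/
lemma steinbergElt_mul_gel_permGL [Fact p.Prime] (s : Equiv.Perm (Fin n)) :
    steinbergElt p n * gel (permGL p n s) =
      ((Equiv.Perm.sign s : ℤ) : ZMod p) • steinbergElt p n := by
  rw [steinbergElt_eq, Finset.sum_mul, Finset.smul_sum]
  refine Fintype.sum_equiv (Equiv.mulRight s) _ _ fun w => ?_
  rw [smul_mul_assoc, mul_gel_mul_gel, ← map_mul, smul_smul, Equiv.coe_mulRight]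
  congr 1
  rw [← Int.cast_mul, Equiv.Perm.sign_mul]
  rcases Int.units_eq_one_or (Equiv.Perm.sign s) with h | h <;> simp [h]

/-- The elementary matrix `1 + x E_{ij}` in the general linear group. -/
def elemGL {i j : Fin n} (hij : i ≠ j) (x : ZMod p) : GLp p n where
  val := Matrix.transvection i j x
  inv := Matrix.transvection i j (-x)
  val_inv := by simp [Matrix.transvection_mul_transvection_same, hij]
  inv_val := by simp [Matrix.transvection_mul_transvection_same, hij]

lemma elemGL_apply {i j : Fin n} (hij : i ≠ j) (x : ZMod p) (r c : Fin n) :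
    (elemGL hij x : Matrix (Fin n) (Fin n) (ZMod p)) r c =
      (if r = c then 1 else 0) + if r = i ∧ c = j then x else 0 := by
  simp [elemGL, Matrix.transvection, Matrix.one_apply, Matrix.single_apply, eq_comm]

lemma elemGL_inv {i j : Fin n} (hij : i ≠ j) (x : ZMod p) :
    (elemGL hij x)⁻¹ = elemGL hij (-x) := by
  rw [inv_eq_iff_mul_eq_one]
  ext1
  simp [elemGL, Matrix.transvection_mul_transvection_same, hij]

lemma elemGL_mul_apply {i j : Fin n} (hij : i ≠ j) (x : ZMod p) (g : GLp p n) (r c : Fin n) :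
    ((elemGL hij x * g : GLp p n) : Matrix (Fin n) (Fin n) (ZMod p)) r c =
      (g : Matrix (Fin n) (Fin n) (ZMod p)) r c +
        if r = i then x * (g : Matrix (Fin n) (Fin n) (ZMod p)) j c else 0 := by
  have : ((elemGL hij x * g : GLp p n) : Matrix (Fin n) (Fin n) (ZMod p)) =
    Matrix.transvection i j x * (g : Matrix (Fin n) (Fin n) (ZMod p)) := rfl
  rw [this]
  by_cases h : r = i
  · subst h; simp
  · simp [h]

/-- With `B` the Borel sum, `S` the transposition and `T`, `T'` the two elementary matrices, `BwT =
Bw`, `BwST' = BwS` and `BwST = BwT'`. Both sides therefore equal `-BwT'`. -/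
lemma steinbergElt_relation_aux [Fact p.Prime] {i j : Fin n} (hij : i ≠ j) {x : ZMod p}
    (hx : x ≠ 0) {w : Equiv.Perm (Fin n)} (hw : w i < w j) :
    borelSum p n * gel (permGL p n w) *
        (1 - gel (elemGL hij x) - gel (elemGL hij.symm x⁻¹)) =
      borelSum p n * gel (permGL p n (w * Equiv.swap i j)) *
        (1 - gel (elemGL hij x) - gel (elemGL hij.symm x⁻¹)) := by
  set S := permGL p n (Equiv.swap i j) with hS
  set T := elemGL hij x with hT
  set T' := elemGL hij.symm x⁻¹ with hT'
  have h1 : borelSum p n * gel (permGL p n w) * gel T = borelSum p n * gel (permGL p n w) := by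
    refine borelSum_mul_permGL_mul_gel fun r c h => ?_
    rw [elemGL_apply, if_neg (by rintro rfl; exact lt_irrefl _ h), if_neg, add_zero]
    rintro ⟨rfl, rfl⟩
    exact lt_asymm h hw
  have h2 : borelSum p n * gel (permGL p n w) * gel S * gel T' =
      borelSum p n * gel (permGL p n w) * gel S := by
    have : gel S * gel T' = gel (S * T' * S⁻¹) * gel S := by simp [gel_mul_gel]
    rw [mul_assoc, this, ← mul_assoc, borelSum_mul_permGL_mul_gel]
    intro r c h
    rw [mul_permGL_inv_apply, permGL_mul_apply, elemGL_apply, if_neg, if_neg, add_zero]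
    · rintro ⟨hr, hc⟩
      simp only [Equiv.swap_inv, Equiv.swap_apply_eq_iff, Equiv.swap_apply_left,
        Equiv.swap_apply_right] at hr hc
      subst hr hc
      exact lt_asymm h hw
    · intro h'
      rw [(Equiv.swap i j)⁻¹.injective h'] at h
      exact lt_irrefl _ h
  -- In rows and columns `i, j`, the matrix `S T T'⁻¹` is `[-x⁻¹ 1; 0 x]`, which is triangular for
  -- the order induced by `w`.
  have h3 : borelSum p n * gel (permGL p n w) * gel S * gel T =
      borelSum p n * gel (permGL p n w) * gel T' := by
    have : gel S * gel T = gel (S * (T * T'⁻¹)) * gel T' := by simp [gel_mul_gel, mul_assoc]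
    rw [mul_assoc, this, ← mul_assoc, borelSum_mul_permGL_mul_gel]
    intro r c h
    rw [permGL_mul_apply, hT', elemGL_inv, elemGL_mul_apply, elemGL_apply, elemGL_apply]
    have hrc : r ≠ c := by rintro rfl; exact lt_irrefl _ h
    rw [Equiv.swap_inv]
    by_cases hr : r = i
    · subst hr
      have hcj : c ≠ j := by rintro rfl; exact lt_asymm h hw
      simp [hij.symm, hcj.symm, hrc.symm]
    · by_cases hr' : r = j
      · subst hr'
        by_cases hc : c = i
        · subst hc; simp [hij, hij.symm, hx]
        · simp [hrc, hc, Ne.symm hc, hij]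
      · rw [Equiv.swap_apply_of_ne_of_ne hr hr']
        simp [hr, hr', hrc]
  rw [map_mul, ← hS, ← gel_mul_gel, ← mul_assoc]
  simp only [mul_sub, mul_one, h1, h2, h3]
  abel

/-- The three-term relation satisfied by Steinberg's element. -/
lemma steinbergElt_relation [Fact p.Prime] {i j : Fin n} (hij : i ≠ j) {x : ZMod p}
    (hx : x ≠ 0) :
    steinbergElt p n =
      steinbergElt p n * gel (elemGL hij x) + steinbergElt p n * gel (elemGL hij.symm x⁻¹) := by
  suffices h : steinbergElt p n *
      (1 - gel (elemGL hij x) - gel (elemGL hij.symm x⁻¹)) = 0 by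
    rw [mul_sub, mul_sub, mul_one, sub_sub, sub_eq_zero] at h
    exact h
  rw [steinbergElt_eq, Finset.sum_mul]
  have key : ∀ w : Equiv.Perm (Fin n), borelSum p n * gel (permGL p n w) *
        (1 - gel (elemGL hij x) - gel (elemGL hij.symm x⁻¹)) =
      borelSum p n * gel (permGL p n (w * Equiv.swap i j)) *
        (1 - gel (elemGL hij x) - gel (elemGL hij.symm x⁻¹)) := by
    intro w
    rcases lt_or_gt_of_ne (w.injective.ne hij) with h | h
    · exact steinbergElt_relation_aux hij hx h
    · have := steinbergElt_relation_aux hij hx (w := w * Equiv.swap i j) (by simpa using h)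
      rw [mul_assoc w, Equiv.swap_mul_self, mul_one] at this
      exact this.symm
  -- The terms of `w` and `w * swap i j` cancel in pairs because their signs are opposite. Nothing
  -- is divided by two, so `p = 2` is included.
  refine Finset.sum_involution (fun w _ => w * Equiv.swap i j) (fun w _ => ?_) (fun w _ _ => ?_)
    (fun _ _ => Finset.mem_univ _) (fun w _ => by simp [mul_assoc])
  · rw [smul_mul_assoc, smul_mul_assoc, ← key w, Equiv.Perm.sign_mul, Equiv.Perm.sign_swap hij]
    simp
  · simpa using hij

end

/-! ### Spanning the Steinberg representation by stabilizer translates -/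

section

variable {p n : ℕ}

/-- The last standard basis vector. -/
def lastVec (p n : ℕ) : Fin (n + 1) → ZMod p := Pi.single (Fin.last n) 1

lemma mulVec_lastVec (g : GLp p (n + 1)) (r : Fin (n + 1)) :
    (g : Matrix (Fin (n + 1)) (Fin (n + 1)) (ZMod p)).mulVec (lastVec p n) r =
      (g : Matrix (Fin (n + 1)) (Fin (n + 1)) (ZMod p)) r (Fin.last n) := by
  simp [lastVec]

/-- The stabilizer of the last standard basis vector. -/
def stabLast (p n : ℕ) : Subgroup (GLp p (n + 1)) where
  carrier := {g | (g : Matrix (Fin (n + 1)) (Fin (n + 1)) (ZMod p)).mulVec (lastVec p n) =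
    lastVec p n}
  mul_mem' {a b} ha hb := by
    simp only [Set.mem_ofPred_eq] at *
    rw [Matrix.GeneralLinearGroup.coe_mul, ← Matrix.mulVec_mulVec, hb, ha]
  one_mem' := by simp
  inv_mem' {a} ha := by
    simp only [Set.mem_ofPred_eq] at *
    conv_lhs => rw [← ha]
    rw [Matrix.mulVec_mulVec, ← Matrix.GeneralLinearGroup.coe_mul]
    simp

lemma mem_stabLast {g : GLp p (n + 1)} : g ∈ stabLast p n ↔
    (g : Matrix (Fin (n + 1)) (Fin (n + 1)) (ZMod p)).mulVec (lastVec p n) = lastVec p n :=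
  Iff.rfl

lemma mem_stabLast_iff {g : GLp p (n + 1)} : g ∈ stabLast p n ↔ ∀ r,
    (g : Matrix (Fin (n + 1)) (Fin (n + 1)) (ZMod p)) r (Fin.last n) = lastVec p n r := by
  rw [mem_stabLast, funext_iff]
  simp only [mulVec_lastVec]

variable [Fact p.Prime]

/-- The span of the translates of Steinberg's element by the stabilizer of the last basis vector. -/
def stabSpan (p n : ℕ) [Fact p.Prime] : Submodule (ZMod p) (GrpAlg p (n + 1)) :=
  Submodule.span (ZMod p) ((fun h => steinbergElt p (n + 1) * gel h) '' (stabLast p n))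

lemma exists_last_ne_zero (g : GLp p (n + 1)) :
    ∃ r, (g : Matrix (Fin (n + 1)) (Fin (n + 1)) (ZMod p)) r (Fin.last n) ≠ 0 := by
  by_contra! h
  refine Matrix.GeneralLinearGroup.det_ne_zero g ?_
  exact Matrix.det_eq_zero_of_column_eq_zero (Fin.last n) h

/-- The diagonal matrix with last entry `d` and all other diagonal entries `1`. -/
def diagLast (n : ℕ) (d : (ZMod p)ˣ) : GLp p (n + 1) :=
  Units.map (Matrix.diagonalRingHom (Fin (n + 1)) (ZMod p)).toMonoidHom
    (MulEquiv.piUnits.symm (Function.update 1 (Fin.last n) d))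

lemma diagLast_mul_apply (d : (ZMod p)ˣ) (g : GLp p (n + 1)) (r c : Fin (n + 1)) :
    ((diagLast n d * g : GLp p (n + 1)) : Matrix (Fin (n + 1)) (Fin (n + 1)) (ZMod p)) r c =
      ((Function.update (1 : Fin (n + 1) → (ZMod p)ˣ) (Fin.last n) d r : (ZMod p)ˣ) : ZMod p) *
        (g : Matrix (Fin (n + 1)) (Fin (n + 1)) (ZMod p)) r c :=
  Matrix.diagonal_mul _ _ _ _

/-- A transposition followed by a diagonal rescaling turns the last column of `g` into the last
basis vector. Multiplying on the left of `g` by these changes the translate of Steinberg's element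
only by a sign. -/
lemma steinbergElt_mul_gel_mem_of_unique {g : GLp p (n + 1)} {i : Fin (n + 1)}
    (hi : (g : Matrix (Fin (n + 1)) (Fin (n + 1)) (ZMod p)) i (Fin.last n) ≠ 0)
    (h : ∀ r, r ≠ i → (g : Matrix (Fin (n + 1)) (Fin (n + 1)) (ZMod p)) r (Fin.last n) = 0) :
    steinbergElt p (n + 1) * gel g ∈ stabSpan p n := by
  set s : Equiv.Perm (Fin (n + 1)) := Equiv.swap i (Fin.last n) with hs
  set t := diagLast n (Units.mk0 _ hi)⁻¹ with ht
  have hmem : t * (permGL p (n + 1) s * g) ∈ stabLast p n := by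
    rw [mem_stabLast_iff]
    intro r
    rw [ht, diagLast_mul_apply, permGL_mul_apply, hs, Equiv.swap_inv]
    rcases eq_or_ne r (Fin.last n) with rfl | hr
    · simp [lastVec, hi]
    · have h0 := h (Equiv.swap i (Fin.last n) r) (by
        rwa [Ne, Equiv.swap_apply_eq_iff, Equiv.swap_apply_left])
      rw [Function.update_of_ne hr, h0]
      simp [lastVec, hr]
  have key : steinbergElt p (n + 1) * gel (t * (permGL p (n + 1) s * g)) =
      ((Equiv.Perm.sign s : ℤ) : ZMod p) • (steinbergElt p (n + 1) * gel g) := by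
    rw [← mul_gel_mul_gel, ← mul_gel_mul_gel, steinbergElt_mul_gel_of_diagonal,
      steinbergElt_mul_gel_permGL, smul_mul_assoc]
    intro r c hrc
    exact Matrix.diagonal_apply_ne _ hrc
  have h2 : steinbergElt p (n + 1) * gel g =
      ((Equiv.Perm.sign s : ℤ) : ZMod p) •
        (steinbergElt p (n + 1) * gel (t * (permGL p (n + 1) s * g))) := by
    rw [key, smul_smul]
    rcases Int.units_eq_one_or (Equiv.Perm.sign s) with h | h <;> simp [h]
  rw [h2]
  exact Submodule.smul_mem _ _ (Submodule.subset_span ⟨_, hmem, rfl⟩)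

/-- The Steinberg representation is spanned by the translates of Steinberg's element by the
stabilizer of the last standard basis vector. -/
lemma steinbergElt_mul_gel_mem (g : GLp p (n + 1)) :
    steinbergElt p (n + 1) * gel g ∈ stabSpan p n := by
  classical
  induction hk : (Finset.univ.filter fun r =>
    (g : Matrix (Fin (n + 1)) (Fin (n + 1)) (ZMod p)) r (Fin.last n) ≠ 0).card
    using Nat.strong_induction_on generalizing g with
  | _ k ih =>
    obtain ⟨i, hi⟩ := exists_last_ne_zero g
    by_cases hu : ∀ r, r ≠ i →
        (g : Matrix (Fin (n + 1)) (Fin (n + 1)) (ZMod p)) r (Fin.last n) = 0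
    · exact steinbergElt_mul_gel_mem_of_unique hi hu
    push Not at hu
    obtain ⟨j, hji, hj⟩ := hu
    have step : ∀ {a b : Fin (n + 1)} (hab : a ≠ b) (x : ZMod p),
        (g : Matrix (Fin (n + 1)) (Fin (n + 1)) (ZMod p)) a (Fin.last n) ≠ 0 →
        (g : Matrix (Fin (n + 1)) (Fin (n + 1)) (ZMod p)) a (Fin.last n) +
          x * (g : Matrix (Fin (n + 1)) (Fin (n + 1)) (ZMod p)) b (Fin.last n) = 0 →
        steinbergElt p (n + 1) * gel (elemGL hab x * g) ∈ stabSpan p n := by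
      intro a b hab x ha h0
      refine ih _ ?_ _ rfl
      rw [← hk]
      refine Finset.card_lt_card ⟨fun r hr => ?_, fun hsub => ?_⟩
      · simp only [Finset.mem_filter, Finset.mem_univ, true_and, elemGL_mul_apply] at hr ⊢
        by_cases hra : r = a
        · subst hra; exact ha
        · simpa [hra] using hr
      · have := hsub (Finset.mem_filter.2 ⟨Finset.mem_univ a, ha⟩)
        simp [elemGL_mul_apply, h0] at this
    set A := (g : Matrix (Fin (n + 1)) (Fin (n + 1)) (ZMod p)) i (Fin.last n)
    set B := (g : Matrix (Fin (n + 1)) (Fin (n + 1)) (ZMod p)) j (Fin.last n)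
    -- This one value of `x` serves both terms of the relation: adding `x` times row `j` to row `i`
    -- clears `A`, and adding `x⁻¹` times row `i` to row `j` clears `B`.
    have hx : -A * B⁻¹ ≠ 0 := mul_ne_zero (neg_ne_zero.2 hi) (inv_ne_zero hj)
    rw [steinbergElt_relation hji.symm hx, add_mul, mul_gel_mul_gel, mul_gel_mul_gel]
    refine Submodule.add_mem _ (step _ _ hi ?_) (step _ _ hj ?_)
    · change A + -A * B⁻¹ * B = 0
      field_simp
      ring
    · change B + (-A * B⁻¹)⁻¹ * A = 0
      field_simp
      ring

lemma steinbergIdeal_le_stabSpan : steinbergIdeal p (n + 1) ≤ stabSpan p n := by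
  rintro _ ⟨x, rfl⟩
  rw [LinearMap.mulLeft_apply]
  induction x using MonoidAlgebra.induction_linear with
  | zero => simp
  | add x y hx hy => rw [mul_add]; exact Submodule.add_mem _ hx hy
  | single g r =>
    rw [single_eq_smul_gel, mul_smul_comm]
    exact Submodule.smul_mem _ _ (steinbergElt_mul_gel_mem g)

end

section

variable {p n : ℕ}

/-! ### The inclusion of `GL_n` in `GL_{n+1}` -/

section Inclusion

lemma glIncl_castSucc_castSucc (a : GLp p n) (r c : Fin n) :
    (glIncl p n a : Matrix (Fin (n + 1)) (Fin (n + 1)) (ZMod p)) r.castSucc c.castSucc =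
      (a : Matrix (Fin n) (Fin n) (ZMod p)) r c := by
  simp [glIncl, blockHom, Fin.castSucc]

lemma glIncl_castSucc_last (a : GLp p n) (r : Fin n) :
    (glIncl p n a : Matrix (Fin (n + 1)) (Fin (n + 1)) (ZMod p)) r.castSucc (Fin.last n) = 0 := by
  simp [glIncl, blockHom, Fin.castSucc, finSumFinEquiv_symm_last]

lemma glIncl_last_castSucc (a : GLp p n) (c : Fin n) :
    (glIncl p n a : Matrix (Fin (n + 1)) (Fin (n + 1)) (ZMod p)) (Fin.last n) c.castSucc = 0 := by
  simp [glIncl, blockHom, Fin.castSucc, finSumFinEquiv_symm_last]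

lemma glIncl_last_last (a : GLp p n) :
    (glIncl p n a : Matrix (Fin (n + 1)) (Fin (n + 1)) (ZMod p)) (Fin.last n) (Fin.last n) = 1 := by
  simp [glIncl, blockHom, finSumFinEquiv_symm_last]

lemma glIncl_injective : Function.Injective (glIncl p n) := by
  intro a b h
  ext r c
  rw [← glIncl_castSucc_castSucc a, h, glIncl_castSucc_castSucc]

lemma glIncl_mem_stabLast (a : GLp p n) : glIncl p n a ∈ stabLast p n := by
  rw [mem_stabLast_iff]
  intro r
  refine Fin.lastCases ?_ (fun r => ?_) r
  · simp [glIncl_last_last, lastVec]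
  · simp [glIncl_castSucc_last, lastVec]

/-- The elements of the stabilizer of the last basis vector with last row `(0, …, 0, 1)` are those
in the image of `GL_n`. -/
lemma exists_glIncl_eq {g : GLp p (n + 1)} (hg : g ∈ stabLast p n)
    (hrow : ∀ c : Fin n,
      (g : Matrix (Fin (n + 1)) (Fin (n + 1)) (ZMod p)) (Fin.last n) c.castSucc = 0) :
    ∃ a, glIncl p n a = g := by
  set A : Matrix (Fin n) (Fin n) (ZMod p) :=
    (g : Matrix (Fin (n + 1)) (Fin (n + 1)) (ZMod p)).submatrix Fin.castSucc Fin.castSucc with hA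
  have hblock : blockHom p n A = (g : Matrix (Fin (n + 1)) (Fin (n + 1)) (ZMod p)) := by
    rw [mem_stabLast_iff] at hg
    ext r c
    refine Fin.lastCases ?_ (fun r => ?_) r <;> refine Fin.lastCases ?_ (fun c => ?_) c
    · rw [hg]; simp [blockHom, finSumFinEquiv_symm_last, lastVec]
    · rw [hrow]; simp [blockHom, finSumFinEquiv_symm_last, Fin.castSucc]
    · rw [hg]; simp [blockHom, finSumFinEquiv_symm_last, lastVec, Fin.castSucc,
        show Fin.castAdd 1 r ≠ Fin.last n from Fin.castSucc_ne_last r]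
    · simp [blockHom, hA, Fin.castSucc]
  have hdet : IsUnit A.det := by
    have h1 : (blockHom p n A).det = A.det := by
      simp [blockHom, Matrix.det_submatrix_equiv_self]
    rw [← h1, hblock]
    exact (Matrix.isUnit_iff_isUnit_det _).1 g.isUnit
  refine ⟨Matrix.GeneralLinearGroup.mk'' A hdet, Units.ext ?_⟩
  exact hblock

/-- The algebra homomorphism induced by `GL_n → GL_{n+1}`. -/
def glInclAlg (p n : ℕ) : GrpAlg p n →ₐ[ZMod p] GrpAlg p (n + 1) :=
  MonoidAlgebra.mapDomainAlgHom (ZMod p) (ZMod p) (glIncl p n)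

lemma glInclAlg_gel (g : GLp p n) : glInclAlg p n (gel g) = gel (glIncl p n g) := by
  simp [glInclAlg, gel]

end Inclusion

/-! ### Coset decomposition of the symmetric group -/

section Permutations

/-- The permutation fixing the last element and acting as `σ` on the others. -/
def extPerm (σ : Equiv.Perm (Fin n)) : Equiv.Perm (Fin (n + 1)) :=
  (finSumFinEquiv (m := n) (n := 1)).permCongr (Equiv.Perm.sumCongr σ 1)

lemma extPerm_castSucc (σ : Equiv.Perm (Fin n)) (i : Fin n) :
    extPerm σ i.castSucc = (σ i).castSucc := by
  simp [extPerm, Fin.castSucc]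

lemma extPerm_last (σ : Equiv.Perm (Fin n)) : extPerm σ (Fin.last n) = Fin.last n := by
  simp [extPerm, finSumFinEquiv_symm_last]
  rfl

lemma sign_extPerm (σ : Equiv.Perm (Fin n)) :
    Equiv.Perm.sign (extPerm σ) = Equiv.Perm.sign σ := by
  simp [extPerm, Equiv.Perm.sign_permCongr]

lemma permGL_apply' (w : Equiv.Perm (Fin n)) (r c : Fin n) :
    (permGL p n w : Matrix (Fin n) (Fin n) (ZMod p)) r c = if r = w c then 1 else 0 := by
  rw [permGL_apply]
  exact if_congr Equiv.Perm.inv_eq_iff_eq rfl rfl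

lemma permGL_extPerm (σ : Equiv.Perm (Fin n)) :
    permGL p (n + 1) (extPerm σ) = glIncl p n (permGL p n σ) := by
  ext r c
  rw [permGL_apply']
  refine Fin.lastCases ?_ (fun c => ?_) c
  · rw [extPerm_last]
    refine Fin.lastCases ?_ (fun r => ?_) r
    · simp [glIncl_last_last]
    · simp [glIncl_castSucc_last]
  · rw [extPerm_castSucc]
    refine Fin.lastCases ?_ (fun r => ?_) r
    · simp [glIncl_last_castSucc, (Fin.castSucc_ne_last _).symm]
    · simp [glIncl_castSucc_castSucc, permGL_apply']

/-- The permutation sending the last element to `i` and increasing on the others. -/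
def insertPerm (i : Fin (n + 1)) : Equiv.Perm (Fin (n + 1)) :=
  (finSuccEquivLast (n := n)).trans (finSuccEquiv' i).symm

lemma insertPerm_last (i : Fin (n + 1)) : insertPerm i (Fin.last n) = i := by
  simp [insertPerm]

lemma insertPerm_castSucc (i : Fin (n + 1)) (j : Fin n) :
    insertPerm i j.castSucc = i.succAbove j := by
  simp [insertPerm]

lemma insertPerm_of_last : insertPerm (Fin.last n) = 1 := by
  ext j : 1
  refine Fin.lastCases ?_ (fun j => ?_) j
  · simp [insertPerm_last]
  · simp [insertPerm_castSucc]

lemma insertPerm_mul_extPerm_bijective :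
    Function.Bijective fun x : Fin (n + 1) × Equiv.Perm (Fin n) =>
      insertPerm x.1 * extPerm x.2 := by
  rw [Fintype.bijective_iff_injective_and_card]
  refine ⟨?_, by simp [Fintype.card_perm, Nat.factorial_succ]⟩
  rintro ⟨i, σ⟩ ⟨j, τ⟩ h
  have hij : i = j := by
    simpa [extPerm_last, insertPerm_last] using congrArg (fun w => w (Fin.last n)) h
  subst hij
  have h2 : extPerm σ = extPerm τ := mul_left_cancel h
  refine Prod.ext rfl (Equiv.ext fun k => ?_)
  simpa [extPerm_castSucc] using congrArg (fun w => w k.castSucc) h2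

variable [Fact p.Prime]

lemma sum_perm_succ {M : Type*} [AddCommMonoid M] (f : Equiv.Perm (Fin (n + 1)) → M) :
    ∑ w, f w = ∑ i, ∑ σ : Equiv.Perm (Fin n), f (insertPerm i * extPerm σ) := by
  rw [← Fintype.sum_prod_type']
  exact (Fintype.sum_bijective _ insertPerm_mul_extPerm_bijective _ _ fun _ => rfl).symm

lemma signedPermSum_succ :
    signedPermSum p (n + 1) =
      (∑ i : Fin (n + 1), ((Equiv.Perm.sign (insertPerm i) : ℤ) : ZMod p) •
        gel (permGL p (n + 1) (insertPerm i))) * glInclAlg p n (signedPermSum p n) := by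
  rw [signedPermSum_eq, sum_perm_succ, signedPermSum_eq, map_sum, Finset.sum_mul]
  refine Finset.sum_congr rfl fun i _ => ?_
  rw [Finset.mul_sum]
  refine Finset.sum_congr rfl fun σ _ => ?_
  rw [map_smul, glInclAlg_gel, ← permGL_extPerm, smul_mul_smul_comm, gel_mul_gel, ← map_mul (permGL p (n + 1)),
    Equiv.Perm.sign_mul, sign_extPerm]
  simp

end Permutations

/-! ### Factoring Steinberg's element through the smaller one -/

section Transfer

/-- An element of a group algebra invariant under right multiplication by a finite subgroup is a
left multiple of the sum of the elements of that subgroup. -/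
lemma exists_eq_mul_sum_subgroup {k G : Type*} [CommRing k] [Group G] [Fintype G]
    (K : Subgroup G) [Fintype K] (A : MonoidAlgebra k G)
    (hA : ∀ h : K, A * MonoidAlgebra.single (h : G) 1 = A) :
    ∃ D : MonoidAlgebra k G, A = D * ∑ h : K, MonoidAlgebra.single (h : G) 1 := by
  classical
  have hcoeff : ∀ (g : G) (h : K), A.coeff (g * h) = A.coeff g := by
    intro g h
    conv_lhs => rw [← hA h]
    simp
  have hsum : A = ∑ g : G, MonoidAlgebra.single g (A.coeff g) := by
    ext g
    rw [MonoidAlgebra.coeff_sum, Finsupp.finsetSum_apply]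
    simp [Finsupp.single_apply]
  -- The witness takes one coefficient per left coset instead of averaging, so the order of `K` need
  -- not be invertible in `k`.
  refine ⟨∑ q : G ⧸ K, MonoidAlgebra.single q.out (A.coeff q.out), ?_⟩
  conv_lhs => rw [hsum]
  rw [Finset.sum_mul_sum, ← Fintype.sum_prod_type']
  refine (Fintype.sum_bijective (fun x : (G ⧸ K) × K => x.1.out * x.2) ⟨?_, fun g => ?_⟩ _ _ ?_).symm
  · rintro ⟨q, h⟩ ⟨q', h'⟩ heq
    have hq : q = q' := by
      have := congrArg (QuotientGroup.mk (s := K)) heq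
      simpa [QuotientGroup.mk_mul_of_mem] using this
    subst hq
    exact Prod.ext rfl (Subtype.ext (mul_left_cancel heq))
  · refine ⟨(QuotientGroup.mk g, ⟨(QuotientGroup.mk g : G ⧸ K).out⁻¹ * g, ?_⟩), by simp⟩
    rw [← QuotientGroup.eq, QuotientGroup.out_eq']
  · rintro ⟨q, h⟩
    rw [hcoeff, MonoidAlgebra.single_mul_single, mul_one]

variable [Fact p.Prime]

/-- The Borel subgroup of upper triangular matrices. -/
def borel (p n : ℕ) [Fact p.Prime] : Subgroup (GLp p n) where
  carrier := {b | (b : Matrix (Fin n) (Fin n) (ZMod p)).IsUpperTriangular}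
  mul_mem' := isUpperTriangular_mul
  one_mem' := Matrix.blockTriangular_one
  inv_mem' := isUpperTriangular_inv

open scoped Classical in
lemma glInclAlg_borelSum : glInclAlg p n (borelSum p n) =
    ∑ h : (borel p n).map (glIncl p n), gel (h : GLp p (n + 1)) := by
  rw [borelSum, map_sum, ← Fintype.sum_equiv
    ((borel p n).equivMapOfInjective _ glIncl_injective).toEquiv
    (fun b : borel p n => gel (glIncl p n b)) _ (fun _ => rfl)]
  rw [Finset.sum_subtype (p := fun b => b ∈ borel p n) _ (by simp [borel])]
  exact Finset.sum_congr rfl fun b _ => glInclAlg_gel _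

/-- Steinberg's element of `GL_{n+1}` is a left multiple of that of `GL_n`. -/
lemma exists_steinbergElt_succ_eq :
    ∃ D, steinbergElt p (n + 1) = D * glInclAlg p n (steinbergElt p n) := by
  classical
  obtain ⟨D, hD⟩ := exists_eq_mul_sum_subgroup ((borel p n).map (glIncl p n))
    (borelSum p (n + 1) *
      ∑ i : Fin (n + 1), ((Equiv.Perm.sign (insertPerm i) : ℤ) : ZMod p) •
        gel (permGL p (n + 1) (insertPerm i))) (by
    rintro ⟨_, b, hb, rfl⟩
    change _ * gel (glIncl p n b) = _
    rw [Finset.mul_sum, Finset.sum_mul]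
    refine Finset.sum_congr rfl fun i _ => ?_
    -- `insertPerm i` is increasing on the first `n` indices, so it conjugates the image of an upper
    -- triangular matrix to an upper triangular one.
    rw [mul_smul_comm, smul_mul_assoc, borelSum_mul_permGL_mul_gel]
    intro r c
    refine Fin.lastCases ?_ (fun r => ?_) r <;> refine Fin.lastCases ?_ (fun c => ?_) c
    · simp
    · simp [glIncl_last_castSucc]
    · simp [glIncl_castSucc_last]
    · rw [insertPerm_castSucc, insertPerm_castSucc, glIncl_castSucc_castSucc]
      exact fun h => hb (Fin.succAbove_lt_succAbove_iff.1 h))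
  refine ⟨D, ?_⟩
  rw [steinbergElt, signedPermSum_succ, ← mul_assoc, hD, steinbergElt, map_mul, ← mul_assoc,
    glInclAlg_borelSum]
  rfl

end Transfer

/-! ### Restriction of functions to `GL_n` -/

section Restriction

/-- Restriction of functions from `GL_{n+1}` to `GL_n`. -/
def restr (p n : ℕ) : GrpAlg p (n + 1) →ₗ[ZMod p] GrpAlg p n where
  toFun := MonoidAlgebra.comapDomain (glIncl p n) glIncl_injective
  map_add' x y := by simp
  map_smul' r x := by ext; simp

lemma coeff_restr (x : GrpAlg p (n + 1)) (a : GLp p n) :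
    (restr p n x).coeff a = x.coeff (glIncl p n a) := by
  simp [restr]

lemma restr_mul_glIncl (x : GrpAlg p (n + 1)) (a : GLp p n) :
    restr p n (x * gel (glIncl p n a)) = restr p n x * gel a := by
  ext g
  simp [coeff_restr, coeff_mul_gel]

variable [Fact p.Prime]

open scoped Classical in
lemma coeff_steinbergElt (g : GLp p n) :
    (steinbergElt p n).coeff g = ∑ w : Equiv.Perm (Fin n),
      if ((g * (permGL p n w)⁻¹ : GLp p n) : Matrix (Fin n) (Fin n) (ZMod p)).IsUpperTriangular
        then ((Equiv.Perm.sign w : ℤ) : ZMod p) else 0 := by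
  rw [steinbergElt_eq, MonoidAlgebra.coeff_sum, Finsupp.finsetSum_apply]
  refine Finset.sum_congr rfl fun w _ => ?_
  rw [MonoidAlgebra.coeff_smul_apply, coeff_mul_gel, coeff_borelSum]
  simp

/-- If `g w⁻¹` is upper triangular, then the last row of `g` is supported at `w⁻¹ (last)`. -/
lemma eq_of_isUpperTriangular_of_last_row_ne_zero {g : GLp p (n + 1)}
    {w : Equiv.Perm (Fin (n + 1))}
    (h : ((g * (permGL p (n + 1) w)⁻¹ : GLp p (n + 1)) :
      Matrix (Fin (n + 1)) (Fin (n + 1)) (ZMod p)).IsUpperTriangular) {c : Fin (n + 1)}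
    (hc : (g : Matrix (Fin (n + 1)) (Fin (n + 1)) (ZMod p)) (Fin.last n) c ≠ 0) :
    w c = Fin.last n := by
  by_contra hw
  apply hc
  have := h (i := Fin.last n) (j := w c) (Fin.lt_last_iff_ne_last.2 hw)
  rw [mul_permGL_inv_apply] at this
  simpa using this

lemma isUpperTriangular_glIncl_iff (a : GLp p n) :
    (glIncl p n a : Matrix (Fin (n + 1)) (Fin (n + 1)) (ZMod p)).IsUpperTriangular ↔
      (a : Matrix (Fin n) (Fin n) (ZMod p)).IsUpperTriangular := by
  constructor
  · intro h r c hrc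
    rw [← glIncl_castSucc_castSucc]
    exact h (Fin.castSucc_lt_castSucc_iff.2 hrc)
  · intro h r c
    refine Fin.lastCases ?_ (fun r => ?_) r <;> refine Fin.lastCases ?_ (fun c => ?_) c
    · simp
    · simp [glIncl_last_castSucc]
    · simp [glIncl_castSucc_last]
    · rw [glIncl_castSucc_castSucc]
      exact fun hrc => h (Fin.castSucc_lt_castSucc_iff.1 hrc)

/-- The corner entry `1` of an element of `GL_n` forces every contributing `w` to fix the last
index, which leaves exactly the sum over `S_n`. -/
lemma restr_steinbergElt : restr p n (steinbergElt p (n + 1)) = steinbergElt p n := by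
  classical
  ext a
  rw [coeff_restr, coeff_steinbergElt, coeff_steinbergElt, sum_perm_succ,
    Finset.sum_eq_single (Fin.last n)]
  · refine Finset.sum_congr rfl fun σ _ => ?_
    rw [insertPerm_of_last, one_mul, sign_extPerm, permGL_extPerm, ← map_inv, ← map_mul]
    exact if_congr (isUpperTriangular_glIncl_iff _) rfl rfl
  · intro i _ hi
    refine Finset.sum_eq_zero fun σ _ => if_neg fun h => hi ?_
    have := eq_of_isUpperTriangular_of_last_row_ne_zero h (c := Fin.last n)
      (by rw [glIncl_last_last]; exact one_ne_zero)
    simpa [extPerm_last, insertPerm_last] using this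
  · simp

/-- If `g = ι(a) h⁻¹` lies in the support of Steinberg's element, its last row has a single nonzero
entry. As `g` fixes the last basis vector, that row is `(0, …, 0, 1)`, so `g`, and hence `h`, comes
from `GL_n`. -/
lemma restr_steinbergElt_mul_eq_zero {h : GLp p (n + 1)} (hh : h ∈ stabLast p n)
    (hn : ∀ a, glIncl p n a ≠ h) : restr p n (steinbergElt p (n + 1) * gel h) = 0 := by
  classical
  ext a
  rw [coeff_restr, coeff_mul_gel, coeff_steinbergElt, MonoidAlgebra.coeff_zero, Finsupp.zero_apply]
  refine Finset.sum_eq_zero fun w _ => if_neg fun hw => ?_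
  set g := glIncl p n a * h⁻¹ with hg
  have hgs : g ∈ stabLast p n := mul_mem (glIncl_mem_stabLast a) (inv_mem hh)
  have hlast := eq_of_isUpperTriangular_of_last_row_ne_zero hw (c := Fin.last n) (by
    rw [mem_stabLast_iff.1 hgs]; simp [lastVec])
  obtain ⟨b, hb⟩ := exists_glIncl_eq hgs fun c => by
    by_contra hc
    have := eq_of_isUpperTriangular_of_last_row_ne_zero hw hc
    exact Fin.castSucc_ne_last c (w.injective (this.trans hlast.symm))
  refine hn (b⁻¹ * a) ?_
  rw [map_mul, map_inv, hb, hg]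
  group

lemma restr_mem_steinbergIdeal {x : GrpAlg p (n + 1)} (hx : x ∈ steinbergIdeal p (n + 1)) :
    restr p n x ∈ steinbergIdeal p n := by
  suffices h : stabSpan p n ≤ (steinbergIdeal p n).comap (restr p n) from
    h (steinbergIdeal_le_stabSpan hx)
  refine Submodule.span_le.2 ?_
  rintro _ ⟨h, hh, rfl⟩
  change restr p n (steinbergElt p (n + 1) * gel h) ∈ steinbergIdeal p n
  by_cases hn : ∃ a, glIncl p n a = h
  · obtain ⟨a, rfl⟩ := hn
    rw [restr_mul_glIncl, restr_steinbergElt]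
    exact ⟨gel a, rfl⟩
  · push Not at hn
    rw [restr_steinbergElt_mul_eq_zero hh hn]
    exact zero_mem _

end Restriction

end

/-! ### Frobenius reciprocity -/

section Frobenius

open Representation

variable {k G H A B : Type*} [CommRing k] [Group G] [Group H] [AddCommGroup A] [Module k A]
  [AddCommGroup B] [Module k B]

/-- Frobenius reciprocity: a `G`-equivariant map into an `H`-representation extends to the induced
representation. -/
lemma exists_indHom (φ : G →* H) (ρ : Representation k G A) (τ : Representation k H B)
    (f : A →ₗ[k] B) (hf : ∀ g a, f (ρ g a) = τ (φ g) (f a)) :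
    ∃ F : IntertwiningMap (ind φ ρ) τ, ∀ h a, F.toLinearMap (IndV.mk φ ρ h a) = τ h⁻¹ (f a) := by
  let F₀ : k[H] ⊗[k] A →ₗ[k] B := TensorProduct.lift
    ((Finsupp.lift _ _ _ fun h => τ h⁻¹ ∘ₗ f) ∘ₗ (MonoidAlgebra.coeffLinearEquiv k).toLinearMap)
  have hF₀ : ∀ h a, F₀ (MonoidAlgebra.single h 1 ⊗ₜ a) = τ h⁻¹ (f a) := by
    intro h a
    simp [F₀]
  have hinv : ∀ g, F₀ ∘ₗ (tprod ((leftRegular k H).comp φ) ρ) g = F₀ := by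
    intro g
    refine TensorProduct.ext (MonoidAlgebra.lhom_ext' fun h => LinearMap.ext_ring ?_)
    ext a
    have h1 : (tprod ((leftRegular k H).comp φ) ρ) g (MonoidAlgebra.single h 1 ⊗ₜ a) =
        MonoidAlgebra.single (φ g * h) 1 ⊗ₜ ρ g a := by
      simp
    change F₀ ((tprod ((leftRegular k H).comp φ) ρ) g (MonoidAlgebra.single h 1 ⊗ₜ a)) =
      F₀ (MonoidAlgebra.single h 1 ⊗ₜ a)
    rw [h1, hF₀, hF₀, hf, ← Module.End.mul_apply, ← map_mul]
    simp
  have hmk : ∀ h a, (Coinvariants.lift _ F₀ hinv) (IndV.mk φ ρ h a) = τ h⁻¹ (f a) :=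
    fun h a => hF₀ h a
  refine ⟨⟨Coinvariants.lift _ F₀ hinv, fun h => ?_⟩, hmk⟩
  refine IndV.hom_ext _ _ fun h' => LinearMap.ext fun a => ?_
  simp only [LinearMap.comp_apply]
  have := ind_mk φ ρ h h' a
  simp only [IndV.mk, LinearMap.comp_apply] at this hmk
  rw [this, hmk, hmk, mul_inv_rev, inv_inv, map_mul, Module.End.mul_apply]

/-- This is the defining relation of the coinvariants; it permits changing a coset representative.
-/
lemma IndV_mk_map_mul (φ : G →* H) (ρ : Representation k G A) (g : G) (h : H) (a : A) :
    IndV.mk φ ρ (φ g * h) (ρ g a) = IndV.mk φ ρ h a := by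
  refine (Coinvariants.mk_eq_iff _).2 (Coinvariants.mem_ker_of_eq g
    (MonoidAlgebra.single h 1 ⊗ₜ a) _ ?_)
  simp

end Frobenius

variable {p n : ℕ}

/-! ### The dual of `J(V_n)` as an augmentation ideal -/

section Augmentation

/-- The class in `J(V_n)` of the indicator function of `v`. -/
def indicatorClass (v : Fin n → ZMod p) : Fun p n ⧸ constFun p n :=
  (constFun p n).mkQ (Pi.single v 1)

/-- The functional `φ ↦ φ v - φ 0` on `J(V_n)`. -/
def evalSub (v : Fin n → ZMod p) : Module.Dual (ZMod p) (Fun p n ⧸ constFun p n) :=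
  (constFun p n).liftQ
    { toFun φ := φ v - φ 0
      map_add' φ χ := add_sub_add_comm _ _ _ _
      map_smul' r φ := (mul_sub _ _ _).symm } (by
    rintro _ ⟨c, rfl⟩
    exact sub_self c)

lemma evalSub_mkQ (v : Fin n → ZMod p) (φ : Fun p n) :
    evalSub v ((constFun p n).mkQ φ) = φ v - φ 0 := rfl

lemma evalSub_zero : evalSub (0 : Fin n → ZMod p) = 0 := by
  refine Submodule.linearMap_qext _ (LinearMap.ext fun φ => ?_)
  exact sub_self (φ 0)

lemma evalSub_indicatorClass (v : Fin n → ZMod p) {w : Fin n → ZMod p} (hw : w ≠ 0) :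
    evalSub v (indicatorClass w) = if v = w then 1 else 0 := by
  rw [indicatorClass, evalSub_mkQ, Pi.single_apply, Pi.single_apply, if_neg (Ne.symm hw), sub_zero]

lemma dual_J_apply_evalSub (g : GLp p n) (v : Fin n → ZMod p) :
    (J p n).dual (MulOpposite.op g) (evalSub v) =
      evalSub (((g⁻¹ : GLp p n) : Matrix (Fin n) (Fin n) (ZMod p)).mulVec v) := by
  refine Submodule.linearMap_qext _ (LinearMap.ext fun φ => ?_)
  change φ (((g⁻¹ : GLp p n) : Matrix (Fin n) (Fin n) (ZMod p)).mulVec v) -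
      φ (((g⁻¹ : GLp p n) : Matrix (Fin n) (Fin n) (ZMod p)).mulVec 0) = φ _ - φ 0
  rw [Matrix.mulVec_zero]

/-- A functional killing the constants has coefficients summing to zero, so each evaluation at `v`
may be replaced by its difference with evaluation at `0`. -/
lemma dual_eq_sum_evalSub [Fact p.Prime] (f : Module.Dual (ZMod p) (Fun p n ⧸ constFun p n)) :
    f = ∑ v, f (indicatorClass v) • evalSub v := by
  have hφ : ∀ φ : Fun p n, f ((constFun p n).mkQ φ) = ∑ v, f (indicatorClass v) * φ v := by
    intro φ
    conv_lhs => rw [pi_eq_sum_univ' φ]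
    rw [map_sum, map_sum]
    refine Finset.sum_congr rfl fun v _ => ?_
    simp [indicatorClass, mul_comm]
  have h1 : ∑ v, f (indicatorClass v) = 0 := by
    have := hφ 1
    rw [show (constFun p n).mkQ (1 : Fun p n) = 0 from
      (Submodule.Quotient.mk_eq_zero _).2 ⟨1, rfl⟩, map_zero] at this
    simpa using this.symm
  refine Submodule.linearMap_qext _ (LinearMap.ext fun φ => ?_)
  rw [LinearMap.comp_apply, LinearMap.comp_apply, hφ, LinearMap.sum_apply]
  simp only [LinearMap.smul_apply, evalSub_mkQ, smul_eq_mul, mul_sub, Finset.sum_sub_distrib]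
  rw [← Finset.sum_mul, h1, zero_mul, sub_zero]

lemma exists_mulVec_lastVec_eq [Fact p.Prime] {v : Fin (n + 1) → ZMod p} (hv : v ≠ 0) :
    ∃ g : GLp p (n + 1),
      (g : Matrix (Fin (n + 1)) (Fin (n + 1)) (ZMod p)).mulVec (lastVec p n) = v := by
  obtain ⟨i, hi⟩ := Function.ne_iff.1 hv
  set s : Equiv.Perm (Fin (n + 1)) := Equiv.swap i (Fin.last n) with hs
  set M : Matrix (Fin (n + 1)) (Fin (n + 1)) (ZMod p) :=
    (1 : Matrix _ _ (ZMod p)).updateCol (Fin.last n) (v ∘ s) with hM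
  have hdet : M.det ≠ 0 := by
    -- By Cramer's rule for the identity matrix, the determinant is the last entry of `v ∘ s`,
    -- namely `v i`.
    rw [hM, ← Matrix.cramer_apply, Matrix.cramer_one]
    simpa [hs] using hi
  refine ⟨permGL p (n + 1) s * Matrix.GeneralLinearGroup.mkOfDetNeZero M hdet, ?_⟩
  ext r
  rw [mulVec_lastVec, permGL_mul_apply]
  change M _ _ = _
  simp [hM, hs]

lemma mulVec_lastVec_ne_zero [Fact p.Prime] (g : GLp p (n + 1)) :
    (g : Matrix (Fin (n + 1)) (Fin (n + 1)) (ZMod p)).mulVec (lastVec p n) ≠ 0 := by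
  intro h
  obtain ⟨r, hr⟩ := exists_last_ne_zero g
  rw [← mulVec_lastVec, h] at hr
  exact hr rfl

end Augmentation

variable [Fact p.Prime]

/-! ### Maps between `St_n` and `St_{n+1}` -/

section Steinberg

/-- The element `e x` of the right ideal generated by Steinberg's element `e`. -/
def stMk (x : GrpAlg p n) : steinbergIdeal p n := ⟨steinbergElt p n * x, x, rfl⟩

lemma exists_stMk_eq (y : steinbergIdeal p n) : ∃ x, stMk x = y := by
  obtain ⟨_, x, rfl⟩ := y
  exact ⟨x, rfl⟩

lemma St_stMk (g : GLp p n) (x : GrpAlg p n) :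
    St p n (MulOpposite.op g) (stMk x) = stMk (x * gel g) :=
  Subtype.ext (mul_assoc _ _ _)

/-- The map `St_n → St_{n+1}` sending `e_n x` to `e_{n+1} x`. -/
lemma exists_suspension (p n : ℕ) [Fact p.Prime] :
    ∃ ψ : steinbergIdeal p n →ₗ[ZMod p] steinbergIdeal p (n + 1),
      ∀ x, ψ (stMk x) = stMk (glInclAlg p n x) := by
  obtain ⟨D, hD⟩ := exists_steinbergElt_succ_eq (p := p) (n := n)
  have h : ∀ x, D * glInclAlg p n (steinbergElt p n * x) =
      steinbergElt p (n + 1) * glInclAlg p n x := fun x => by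
    rw [map_mul, ← mul_assoc, ← hD]
  refine ⟨LinearMap.codRestrict _
    (LinearMap.mulLeft (ZMod p) D ∘ₗ (glInclAlg p n).toLinearMap ∘ₗ (steinbergIdeal p n).subtype)
    ?_, fun x => Subtype.ext (h x)⟩
  rintro ⟨_, x, rfl⟩
  exact ⟨glInclAlg p n x, (h x).symm⟩

/-- Restriction of functions as a map `St_{n+1} → St_n`. -/
def stRestr (p n : ℕ) [Fact p.Prime] :
    steinbergIdeal p (n + 1) →ₗ[ZMod p] steinbergIdeal p n :=
  (restr p n).restrict fun _ => restr_mem_steinbergIdeal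

lemma restr_mul_glInclAlg (x : GrpAlg p (n + 1)) (y : GrpAlg p n) :
    restr p n (x * glInclAlg p n y) = restr p n x * y := by
  induction y using MonoidAlgebra.induction_linear with
  | zero => simp
  | add y z hy hz => rw [map_add, mul_add, map_add, hy, hz, mul_add]
  | single g r =>
    rw [single_eq_smul_gel, map_smul, glInclAlg_gel, mul_smul_comm, map_smul, restr_mul_glIncl,
      mul_smul_comm]

/-- Restriction commutes with right multiplication by `GL_n`, so it splits the suspension `St_n →
St_{n+1}`. -/
lemma stRestr_stMk_glInclAlg (x : GrpAlg p n) :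
    stRestr p n (stMk (glInclAlg p n x)) = stMk x := by
  refine Subtype.ext ?_
  change restr p n (steinbergElt p (n + 1) * glInclAlg p n x) = steinbergElt p n * x
  rw [restr_mul_glInclAlg, restr_steinbergElt]

lemma stRestr_stMk_mul_eq_zero {k : GLp p (n + 1)} (hk : k ∈ stabLast p n)
    (hn : k ∉ (glIncl p n).range) (x : GrpAlg p n) :
    stRestr p n (stMk (glInclAlg p n x * gel k)) = 0 := by
  refine Subtype.ext ?_
  change restr p n (steinbergElt p (n + 1) * (glInclAlg p n x * gel k)) = 0
  induction x using MonoidAlgebra.induction_linear with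
  | zero => simp
  | add y z hy hz => rw [map_add, add_mul, mul_add, map_add, hy, hz, add_zero]
  | single g r =>
    rw [single_eq_smul_gel, map_smul, glInclAlg_gel, smul_mul_assoc, mul_smul_comm, map_smul,
      gel_mul_gel, restr_steinbergElt_mul_eq_zero (mul_mem (glIncl_mem_stabLast g) hk), smul_zero]
    rintro a ha
    refine hn ⟨g⁻¹ * a, ?_⟩
    rw [map_mul, ha, map_inv, inv_mul_cancel_left]

end Steinberg

/-! ### The left inverse and the generation of the tensor product -/

section Comparison

open Representation

/-- A linear map from `J(V_{n+1})^# ⊗ St_{n+1}` to the representation induced from `St_n`. -/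
def toInd (p n : ℕ) [Fact p.Prime] :
    Module.Dual (ZMod p) (Fun p (n + 1) ⧸ constFun p (n + 1)) ⊗[ZMod p] steinbergIdeal p (n + 1)
      →ₗ[ZMod p] IndV (MonoidHom.op (glIncl p n)) (St p n) :=
  ∑ᶠ q : GLp p (n + 1) ⧸ (glIncl p n).range, TensorProduct.lift
    ((LinearMap.lsmul (ZMod p) (IndV (MonoidHom.op (glIncl p n)) (St p n))).compl₁₂
      (LinearMap.applyₗ (indicatorClass
        ((q.out : Matrix (Fin (n + 1)) (Fin (n + 1)) (ZMod p)).mulVec (lastVec p n))))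
      (IndV.mk _ _ (MulOpposite.op q.out) ∘ₗ stRestr p n ∘ₗ
        St p (n + 1) (MulOpposite.op q.out)))

open scoped Classical in
lemma toInd_tmul (f : Module.Dual (ZMod p) (Fun p (n + 1) ⧸ constFun p (n + 1)))
    (y : steinbergIdeal p (n + 1)) :
    toInd p n (f ⊗ₜ y) = ∑ q : GLp p (n + 1) ⧸ (glIncl p n).range,
      f (indicatorClass
          ((q.out : Matrix (Fin (n + 1)) (Fin (n + 1)) (ZMod p)).mulVec (lastVec p n))) •
        IndV.mk (MonoidHom.op (glIncl p n)) (St p n) (MulOpposite.op q.out)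
          (stRestr p n (St p (n + 1) (MulOpposite.op q.out) y)) := by
  rw [toInd, finsum_eq_sum_of_fintype, LinearMap.sum_apply]
  rfl

/-- Only the coset of `g` contributes. A coset `q` moving the last basis vector elsewhere is killed
by the functional; one with the same image has `g⁻¹ q` in the stabilizer but outside `GL_n`, and is
killed by restriction. -/
lemma toInd_evalSub_tmul (g : GLp p (n + 1)) (x : GrpAlg p n) :
    toInd p n (evalSub ((g : Matrix (Fin (n + 1)) (Fin (n + 1)) (ZMod p)).mulVec (lastVec p n)) ⊗ₜ
        stMk (glInclAlg p n x * gel g⁻¹)) =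
      IndV.mk (MonoidHom.op (glIncl p n)) (St p n) (MulOpposite.op g) (stMk x) := by
  classical
  rw [toInd_tmul, Finset.sum_eq_single (QuotientGroup.mk g)]
  · obtain ⟨⟨_, a, rfl⟩, ha⟩ := QuotientGroup.mk_out_eq_mul (glIncl p n).range g
    rw [ha, Matrix.GeneralLinearGroup.coe_mul, ← Matrix.mulVec_mulVec,
      mem_stabLast.1 (glIncl_mem_stabLast a),
      evalSub_indicatorClass _ (mulVec_lastVec_ne_zero g), if_pos rfl, one_smul, St_stMk,
      mul_gel_mul_gel, inv_mul_cancel_left, ← glInclAlg_gel, ← map_mul, stRestr_stMk_glInclAlg,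
      ← St_stMk]
    exact IndV_mk_map_mul (MonoidHom.op (glIncl p n)) (St p n) (MulOpposite.op a)
      (MulOpposite.op g) (stMk x)
  · intro q _ hq
    rw [evalSub_indicatorClass _ (mulVec_lastVec_ne_zero _)]
    split_ifs with h
    · rw [St_stMk, mul_gel_mul_gel, stRestr_stMk_mul_eq_zero, map_zero, smul_zero]
      · rw [mem_stabLast, Matrix.GeneralLinearGroup.coe_mul, ← Matrix.mulVec_mulVec, ← h,
          Matrix.mulVec_mulVec, ← Matrix.GeneralLinearGroup.coe_mul]
        simp
      · rw [← QuotientGroup.eq, QuotientGroup.out_eq']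
        exact hq.symm
    · rw [zero_smul]
  · simp

/-- A subrepresentation of `J(V_{n+1})^# ⊗ St_{n+1}` containing the tensor of the functional
attached to the last basis vector with Steinberg's element is everything. -/
lemma eq_top_of_evalSub_tmul_mem
    (R : Submodule (ZMod p) (Module.Dual (ZMod p) (Fun p (n + 1) ⧸ constFun p (n + 1)) ⊗[ZMod p]
      steinbergIdeal p (n + 1)))
    (hR : ∀ g : GLp p (n + 1), ∀ z ∈ R,
      tprod (J p (n + 1)).dual (St p (n + 1)) (MulOpposite.op g) z ∈ R)
    (h1 : evalSub (lastVec p n) ⊗ₜ stMk 1 ∈ R) : R = ⊤ := by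
  have hact : ∀ (g : GLp p (n + 1)) (v : Fin (n + 1) → ZMod p) (y : steinbergIdeal p (n + 1)),
      tprod (J p (n + 1)).dual (St p (n + 1)) (MulOpposite.op g) (evalSub v ⊗ₜ y) =
        evalSub (((g⁻¹ : GLp p (n + 1)) :
          Matrix (Fin (n + 1)) (Fin (n + 1)) (ZMod p)).mulVec v) ⊗ₜ
          St p (n + 1) (MulOpposite.op g) y := by
    intro g v y
    rw [← dual_J_apply_evalSub]
    rfl
  have h2 : ∀ y, evalSub (lastVec p n) ⊗ₜ y ∈ R := by
    -- The stabilizer fixes the functional, so it moves only the Steinberg factor.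
    have hle : stabSpan p n ≤ (R.comap (TensorProduct.mk (ZMod p) _ _
        (evalSub (lastVec p n)))).map (steinbergIdeal p (n + 1)).subtype := by
      refine Submodule.span_le.2 ?_
      rintro _ ⟨h, hh, rfl⟩
      refine ⟨stMk (gel h), ?_, rfl⟩
      have := hR h _ h1
      rwa [hact, mem_stabLast.1 (inv_mem hh), St_stMk, one_mul] at this
    intro y
    obtain ⟨z, hz, hzy⟩ := hle (steinbergIdeal_le_stabSpan y.2)
    rwa [← Subtype.ext (a1 := z) (a2 := y) hzy]
  have h3 : ∀ v y, evalSub v ⊗ₜ y ∈ R := by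
    intro v y
    rcases eq_or_ne v 0 with rfl | hv
    · rw [evalSub_zero, TensorProduct.zero_tmul]
      exact zero_mem _
    · obtain ⟨g, rfl⟩ := exists_mulVec_lastVec_eq hv
      have := hR g⁻¹ _ (h2 (St p (n + 1) (MulOpposite.op g) y))
      rwa [hact, inv_inv, ← Module.End.mul_apply, ← map_mul, ← MulOpposite.op_mul, mul_inv_cancel,
        MulOpposite.op_one, map_one, Module.End.one_apply] at this
  rw [eq_top_iff]
  rintro z -
  induction z using TensorProduct.induction_on with
  | zero => exact zero_mem _
  | add x y hx hy => exact add_mem hx hy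
  | tmul f y =>
    rw [dual_eq_sum_evalSub f, TensorProduct.sum_tmul]
    refine Submodule.sum_mem _ fun v _ => ?_
    rw [← TensorProduct.smul_tmul']
    exact Submodule.smul_mem _ _ (h3 v y)

end Comparison

end

end GLSteinberg

open GLSteinberg in
theorem lemma4p2 (p : ℕ) [Fact p.Prime] (n : ℕ) :
    Nonempty (Representation.Equiv
      (GLSteinberg.Ind p n (GLSteinberg.St p n))
      (Representation.tprod (GLSteinberg.J p (n + 1)).dual (GLSteinberg.St p (n + 1)))) := by
  obtain ⟨ψ, hψ⟩ := exists_suspension p n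
  let f : steinbergIdeal p n →ₗ[ZMod p]
      TensorProduct (ZMod p) (Module.Dual (ZMod p) (Fun p (n + 1) ⧸ constFun p (n + 1)))
        (steinbergIdeal p (n + 1)) :=
    TensorProduct.mk (ZMod p) _ _ (evalSub (lastVec p n)) ∘ₗ ψ
  have hf : ∀ g y, f (St p n g y) =
      Representation.tprod (J p (n + 1)).dual (St p (n + 1)) (MonoidHom.op (glIncl p n) g)
        (f y) := by
    rintro ⟨g⟩ y
    obtain ⟨x, rfl⟩ := exists_stMk_eq y
    change evalSub (lastVec p n) ⊗ₜ[ZMod p] ψ (St p n (MulOpposite.op g) (stMk x)) =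
      (J p (n + 1)).dual (MulOpposite.op (glIncl p n g)) (evalSub (lastVec p n)) ⊗ₜ[ZMod p]
        St p (n + 1) (MulOpposite.op (glIncl p n g)) (ψ (stMk x))
    rw [dual_J_apply_evalSub, mem_stabLast.1 (inv_mem (glIncl_mem_stabLast g)), St_stMk, hψ, hψ,
      St_stMk, map_mul, glInclAlg_gel]
  obtain ⟨F, hF⟩ := exists_indHom (B := TensorProduct (ZMod p)
    (Module.Dual (ZMod p) (Fun p (n + 1) ⧸ constFun p (n + 1))) (steinbergIdeal p (n + 1)))
    (MonoidHom.op (glIncl p n)) (St p n)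
    (Representation.tprod (J p (n + 1)).dual (St p (n + 1))) f hf
  have hF' : ∀ (g : GLp p (n + 1)) (x : GrpAlg p n),
      F.toLinearMap (Representation.IndV.mk _ _ (MulOpposite.op g) (stMk x)) =
        evalSub ((g : Matrix (Fin (n + 1)) (Fin (n + 1)) (ZMod p)).mulVec (lastVec p n)) ⊗ₜ[ZMod p]
          stMk (glInclAlg p n x * gel g⁻¹) := by
    intro g x
    rw [hF]
    change (J p (n + 1)).dual (MulOpposite.op g⁻¹) (evalSub (lastVec p n)) ⊗ₜ[ZMod p]
      St p (n + 1) (MulOpposite.op g⁻¹) (ψ (stMk x)) = _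
    rw [dual_J_apply_evalSub, inv_inv, hψ, St_stMk]
  refine ⟨F.ofBijective ⟨?_, ?_⟩⟩
  · have hleft : toInd p n ∘ₗ F.toLinearMap = LinearMap.id := by
      refine Representation.IndV.hom_ext _ _ fun h => LinearMap.ext fun y => ?_
      obtain ⟨x, rfl⟩ := exists_stMk_eq y
      change toInd p n (F.toLinearMap
        (Representation.IndV.mk _ _ (MulOpposite.op h.unop) (stMk x))) = _
      rw [hF', toInd_evalSub_tmul]
      rfl
    exact Function.LeftInverse.injective (g := toInd p n) (LinearMap.congr_fun hleft)
  · refine LinearMap.range_eq_top.1 (eq_top_of_evalSub_tmul_mem (LinearMap.range F.toLinearMap) ?_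
      ⟨Representation.IndV.mk _ _ (MulOpposite.op 1) (stMk 1), ?_⟩)
    · rintro g _ ⟨z, rfl⟩
      exact ⟨_, LinearMap.congr_fun (F.isIntertwining' (MulOpposite.op g)) z⟩
    · rw [hF', map_one, one_mul, inv_one, gel_one, Units.val_one, Matrix.one_mulVec]
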